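/- Let $\alpha,\beta\in\mathbb R$ and let $m\ge 0$ be an integer. Let $$P_m(x)=P_m^{(-\alpha-1,\beta-1)}(x)$$ be the Jacobi polynomial, where $P_n^{(a,b)}(x)=\frac{(a+1)_n}{n!}\,{}_2F_1\!\left(-n,n+a+b+1;a+1;\tfrac{1-x}{2}\right)$, continued polynomially in $a,b$, and assume $P_m\not\equiv 0$. With $x=-\cos 2\theta$, $0<\theta<\pi/2$, put $$W_m=-\frac{d}{dx}\ln\left((1+x)^{\beta/2-1/4}(1-x)^{-\alpha/2-1/4}P_m(x)\right),$$ $$A=2\sqrt{1-x^2}\left(\tfrac{d}{dx}+W_m\right),\qquad A^\dagger=2\sqrt{1-x^2}\left(-\tfrac{d}{dx}+W_m\right),$$ $$L^{(2)}=AA^\dagger+(2m-\alpha+\beta-1)^2,\qquad H=-\frac1{2r}\partial_r r\partial_r+\frac12\omega^2r^2+\frac1{2r^2}L^{(2)}\qquad(\omega\in\mathbb R).$$ Consider these on $r>0$, $0<\theta<\pi/2$, away from the zeros of $P_m(-\cos2\theta)$. Then: 1. $H=-\frac12\Delta+V$, where $V=\frac12\omega^2r^2+r^{-2}S(\theta)$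 and $S(\theta)=\dfrac{N(x)}{(1-x^2)P_m(x)^2}$ for a real polynomial $N$ independent of $\omega$. 2. There are a rational function $W(y)$, of the form (real polynomial in $y$)$/P_m(1-2y)$, and real constants $q_7,\dots,q_{10}$, all independent of $\omega$, such that $$V=\frac12\omega^2r^2+\frac1{r^2}T'(\theta),\qquad T(\theta)=\frac{-2W(y)}{\sin\theta\cos\theta}-\frac{\kappa}{\tan2\theta},\qquad y=\tfrac12(1+\cos2\theta),$$ with $\kappa=\alpha^2-\alpha\beta+\beta^2+\frac74+2(m-1)(m+\beta-\alpha)$ (and $1/\tan 2\theta$ read as $\cot 2\theta$), and such that, at all $y\in(0,1)$ with $P_m(1-2y)\neq0$, $W$ satisfies Cosgrove's equation SD-I.a $$y^2(1-y)^2(W'')^2+4W'(yW'-W)^2-4(W')^2(yW'-W)+4q_7(W')^2+4q_8W'+4q_9(yW'-W)+4q_{10}=0 .$$ 3. $W$, hence the potential, is expressed through a sixth Painlevé transcendent: there are real $\gamma_1,\dots,\gamma_4$, a real $t$ with $t^2=2\gamma_1$, and a function $u$ that, on $(0,1)$ minus a finite set, is analytic, avoids the values $0,1,y$, solves $$u''=\tfrac12\left(\tfrac1u+\tfrac1{u-1}+\tfrac1{u-y}\right)u'^2-\left(\tfrac1y+\tfrac1{y-1}+\tfrac1{u-y}\right)u'+\tfrac{u(u-1)(u-y)}{y^2(y-1)^2}\left(\gamma_1+\tfrac{\gamma_2y}{u^2}+\tfrac{\gamma_3(y-1)}{(u-1)^2}+\tfrac{\gamma_4y(y-1)}{(u-y)^2}\right),$$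 and satisfies $$W=\tfrac{y^2(y-1)^2}{4u(u-1)(u-y)}\left(u'-\tfrac{u(u-1)}{y(y-1)}\right)^2+\tfrac18(1-t)^2(1-2u)-\tfrac{\gamma_2}4\left(1-\tfrac{2y}{u}\right)-\tfrac{\gamma_3}4\left(1-\tfrac{2(y-1)}{u-1}\right)+\left(\tfrac18-\tfrac{\gamma_4}4\right)\left(1-\tfrac{2y(u-1)}{u-y}\right).$$ The family is infinite: if $\alpha-\beta\notin\mathbb Z$, then $P_m\not\equiv0$ for every $m\ge0$, and for $m\ne n$ there is an angle $\theta\in(0,\pi/2)$, regular for both potentials, at which the potentials of index $m$ and $n$ (for the same $\omega$) differ for every $\omega$ and every $r>0$. -/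

import Mathlib

open scoped Polynomial

noncomputable section

namespace RationalExtension

/-- The Jacobi polynomial `P_n^{(a,b)}`, that is
`((a+1)_n / n!) ₂F₁(-n, n+a+b+1; a+1; (1-x)/2)`, written with the factor `(a+1)_n / (a+1)_k`
simplified to `(a+k+1)_{n-k}`, so that it makes sense for all real `a`, `b`. -/
def jacobiPoly (n : ℕ) (a b : ℝ) : ℝ[X] :=
  ∑ k ∈ Finset.range (n + 1),
    Polynomial.C ((ascPochhammer ℝ k).eval (n + a + b + 1)
        * (ascPochhammer ℝ (n - k)).eval (a + k + 1)
        / ((k.factorial : ℝ) * ((n - k).factorial : ℝ)))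
      * (Polynomial.C (1 / 2) * (Polynomial.X - 1)) ^ k

/-- The polynomial `P_m^{(-α-1, β-1)}` of the Jacobi seed function. -/
def seedPoly (m : ℕ) (α β : ℝ) : ℝ[X] := jacobiPoly m (-α - 1) (β - 1)

/-- The seed function `(1+x)^{β/2-1/4} (1-x)^{-α/2-1/4} P_m^{(-α-1, β-1)}(x)` on `-1 < x < 1`. -/
def seed (m : ℕ) (α β x : ℝ) : ℝ :=
  (1 + x) ^ (β / 2 - 1 / 4) * (1 - x) ^ (-α / 2 - 1 / 4) * (seedPoly m α β).eval x

/-- The superpotential `-(d/dx) ln (seed)`; with this sign `d/dx + superpotential` annihilates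
the seed function. -/
def superpotential (m : ℕ) (α β x : ℝ) : ℝ := -logDeriv (seed m α β) x

/-- `A = 2 √(1-x²) (d/dx + superpotential)`. -/
def opA (m : ℕ) (α β : ℝ) (f : ℝ → ℝ) (x : ℝ) : ℝ :=
  2 * √(1 - x ^ 2) * (deriv f x + superpotential m α β x * f x)

/-- `A† = 2 √(1-x²) (-d/dx + superpotential)`. -/
def opAdag (m : ℕ) (α β : ℝ) (f : ℝ → ℝ) (x : ℝ) : ℝ :=
  2 * √(1 - x ^ 2) * (-deriv f x + superpotential m α β x * f x)

/-- The exceptional angular operator `L⁽²⁾ = A A† + (2m - α + β - 1)²`. The constant is the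
eigenvalue of the seed function, so that `A† A + (2m - α + β - 1)²` is the classical operator
`-∂_θ² + ((α+1)² - 1/4)/cos² θ + ((β-1)² - 1/4)/sin² θ`, where `x = -cos 2θ`. -/
def angularOp (m : ℕ) (α β : ℝ) (f : ℝ → ℝ) (x : ℝ) : ℝ :=
  opA m α β (opAdag m α β f) x + (2 * m - α + β - 1) ^ 2 * f x

/-- The exceptional Hamiltonian `-(1/(2r)) ∂_r r ∂_r + ω² r²/2 + L⁽²⁾/(2r²)`, acting on
functions of `(r, x)`, where `x = -cos 2θ`. -/
def hamiltonian (ω : ℝ) (m : ℕ) (α β : ℝ) (Ψ : ℝ → ℝ → ℝ) (r x : ℝ) : ℝ :=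
  -(1 / (2 * r)) * deriv (fun ρ => ρ * deriv (fun s => Ψ s x) ρ) r
    + ω ^ 2 * r ^ 2 / 2 * Ψ r x
    + 1 / (2 * r ^ 2) * angularOp m α β (Ψ r) x

/-- The Euclidean Laplacian of the plane in polar coordinates. -/
def polarLaplacian (ψ : ℝ → ℝ → ℝ) (r θ : ℝ) : ℝ :=
  deriv (deriv fun s => ψ s θ) r + 1 / r * deriv (fun s => ψ s θ) r
    + 1 / r ^ 2 * deriv (deriv fun t => ψ r t) θ

/-- The potential of the Hamiltonian: if `H = -Δ/2 + V`, then `V` is the value of `H` on the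
constant function `1`. -/
def potential (ω : ℝ) (m : ℕ) (α β r θ : ℝ) : ℝ :=
  hamiltonian ω m α β (fun _ _ => 1) r (-Real.cos (2 * θ))

/-- The angles of the open first quadrant at which the potential is regular. -/
def regularAngles (m : ℕ) (α β : ℝ) : Set ℝ :=
  {θ | 0 < θ ∧ θ < Real.pi / 2 ∧ (seedPoly m α β).eval (-Real.cos (2 * θ)) ≠ 0}

/-- The values of `y = (1 + cos 2θ)/2 = (1 - x)/2` at the regular angles. -/
def regularPoints (m : ℕ) (α β : ℝ) : Set ℝ :=
  {y | 0 < y ∧ y < 1 ∧ (seedPoly m α β).eval (1 - 2 * y) ≠ 0}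

/-- The constant in front of `cot 2θ` in the angular primitive; it equals
`α² - αβ + β² + 7/4` for `m = 1`. -/
def cotCoeff (m : ℕ) (α β : ℝ) : ℝ :=
  α ^ 2 - α * β + β ^ 2 + 7 / 4 + 2 * (m - 1) * (m + β - α)

/-- The function `T(θ) = -2 W(y)/(sin θ cos θ) - κ cot 2θ` with `y = (1 + cos 2θ)/2`. -/
def angularPrimitive (κ : ℝ) (W : ℝ → ℝ) (θ : ℝ) : ℝ :=
  -2 * W ((1 + Real.cos (2 * θ)) / 2) / (Real.sin θ * Real.cos θ)
    - κ * (Real.cos (2 * θ) / Real.sin (2 * θ))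

/-- `W` is an analytic solution on `D` of the equation SD-I.a
`y²(1-y)²W''² + 4W'(yW'-W)² - 4W'²(yW'-W) + 4q₇W'² + 4q₈W' + 4q₉(yW'-W) + 4q₁₀ = 0`. -/
def IsSDIaSolutionOn (q₇ q₈ q₉ q₁₀ : ℝ) (W : ℝ → ℝ) (D : Set ℝ) : Prop :=
  ∀ y ∈ D, AnalyticAt ℝ W y ∧
    y ^ 2 * (1 - y) ^ 2 * deriv (deriv W) y ^ 2
      + 4 * deriv W y * (y * deriv W y - W y) ^ 2
      - 4 * deriv W y ^ 2 * (y * deriv W y - W y)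
      + 4 * q₇ * deriv W y ^ 2 + 4 * q₈ * deriv W y
      + 4 * q₉ * (y * deriv W y - W y) + 4 * q₁₀ = 0

/-- `u` is an analytic solution on `D` of the sixth Painlevé equation with parameters
`γ₁, γ₂, γ₃, γ₄`; in particular it avoids the values `0`, `1`, `y` there. -/
def IsPVISolutionOn (γ₁ γ₂ γ₃ γ₄ : ℝ) (u : ℝ → ℝ) (D : Set ℝ) : Prop :=
  ∀ y ∈ D, y ≠ 0 ∧ y ≠ 1 ∧ AnalyticAt ℝ u y ∧ u y ≠ 0 ∧ u y ≠ 1 ∧ u y ≠ y ∧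
    deriv (deriv u) y =
      1 / 2 * (1 / u y + 1 / (u y - 1) + 1 / (u y - y)) * deriv u y ^ 2
      - (1 / y + 1 / (y - 1) + 1 / (u y - y)) * deriv u y
      + u y * (u y - 1) * (u y - y) / (y ^ 2 * (y - 1) ^ 2)
        * (γ₁ + γ₂ * y / u y ^ 2 + γ₃ * (y - 1) / (u y - 1) ^ 2
          + γ₄ * y * (y - 1) / (u y - y) ^ 2)

/-- Cosgrove's expression of the solutions of SD-I.a through a function `u` that solves the sixth
Painlevé equation with parameters `γ₁, γ₂, γ₃, γ₄`; here `t` is one of the square roots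
of `2γ₁`. -/
def cosgroveExpr (γ₂ γ₃ γ₄ t : ℝ) (u : ℝ → ℝ) (y : ℝ) : ℝ :=
  y ^ 2 * (y - 1) ^ 2 / (4 * u y * (u y - 1) * (u y - y))
      * (deriv u y - u y * (u y - 1) / (y * (y - 1))) ^ 2
    + 1 / 8 * (1 - t) ^ 2 * (1 - 2 * u y)
    - 1 / 4 * γ₂ * (1 - 2 * y / u y)
    - 1 / 4 * γ₃ * (1 - 2 * (y - 1) / (u y - 1))
    + (1 / 8 - 1 / 4 * γ₄) * (1 - 2 * y * (u y - 1) / (u y - y))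

end RationalExtension

end

noncomputable section

namespace RationalExtension

open Polynomial Filter Topology

/-! In the variable `y = (1 - x)/2` the seed polynomial `q` satisfies a hypergeometric equation, so
its logarithmic derivative satisfies a Riccati equation. After an affine normalisation
(`riccatiFun`) this becomes `y (y - 1) u' = A u² + (B y + C) u + D y` with `A + B + C + D = 0`,
which is the classical Riccati reduction of the sixth Painlevé equation. Cosgrove's expression in
such a `u` is affine in `y` for the root `t = A` of `2γ₁`; for `t = -A` it is affine in `y` and `u`.
The latter is `W`, and SD-I.a for it reduces to an algebraic identity in `u` and `y`, since `u'` and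
`u''` can be eliminated.

The superpotential is also affine in `u`, up to the factor `1/(y (1 - y))`. Expanding `A A†`
therefore writes the potential through `W` and `W'`, and the result is the `θ`-derivative of the
stated primitive.

The Painlevé equation excludes `u ≡ 0`, `u ≡ 1` and `u ≡ y`. In these cases `W` is affine in `y`
with slope minus a square, and a different, affine Painlevé function represents it.

For distinctness, equality of two potentials forces the difference of the logarithmic derivatives of
the seed polynomials to be a multiple of `1/√(y (1 - y))`. Being rational it vanishes, which
contradicts the different degrees. -/

/-! ### The seed polynomial and its hypergeometric equation -/

/-- The coefficients of the Jacobi polynomial in powers of `(x - 1)/2`. -/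
def jacobiCoeff (n : ℕ) (a b : ℝ) (k : ℕ) : ℝ :=
  (ascPochhammer ℝ k).eval (n + a + b + 1) * (ascPochhammer ℝ (n - k)).eval (a + k + 1)
    / ((k.factorial : ℝ) * ((n - k).factorial : ℝ))

/-- The seed polynomial in the variable `y = (1 - x)/2`. -/
def angularPoly (m : ℕ) (α β : ℝ) : ℝ[X] := (seedPoly m α β).comp (1 - C 2 * X)

theorem angularPoly_eval (m : ℕ) (α β y : ℝ) :
    (angularPoly m α β).eval y = (seedPoly m α β).eval (1 - 2 * y) := by
  simp [angularPoly]

theorem angularPoly_comp (m : ℕ) (α β : ℝ) :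
    (angularPoly m α β).comp (C (1 / 2) * (1 - X)) = seedPoly m α β := by
  rw [angularPoly, comp_assoc]
  have : (1 - C (2 : ℝ) * X : ℝ[X]).comp (C (1 / 2) * (1 - X)) = X := by
    simp only [sub_comp, one_comp, mul_comp, C_comp, X_comp]
    rw [← mul_assoc, ← C_mul]
    norm_num
  rw [this, comp_X]

theorem seedPoly_ne_zero_iff (m : ℕ) (α β : ℝ) :
    seedPoly m α β ≠ 0 ↔ angularPoly m α β ≠ 0 := by
  constructor
  · intro h h0
    apply h
    rw [← angularPoly_comp, h0, zero_comp]
  · intro h h0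
    apply h
    rw [angularPoly, h0, zero_comp]

theorem angularPoly_eq_sum (m : ℕ) (α β : ℝ) :
    angularPoly m α β = ∑ k ∈ Finset.range (m + 1),
      C ((-1) ^ k * jacobiCoeff m (-α - 1) (β - 1) k) * X ^ k := by
  rw [angularPoly, seedPoly, jacobiPoly, sum_comp]
  refine Finset.sum_congr rfl fun k _ => ?_
  have h : C (1 / 2 : ℝ) * (1 - C (2 : ℝ) * X - 1) = C (-1) * X := by
    rw [sub_sub_cancel_left, mul_neg, ← mul_assoc, ← C_mul]
    norm_num
  simp only [mul_comp, C_comp, pow_comp, sub_comp, X_comp, one_comp]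
  rw [h, mul_pow, ← C_pow, ← mul_assoc, ← C_mul, jacobiCoeff]
  congr 2
  ring

theorem angularPoly_coeff (m : ℕ) (α β : ℝ) (k : ℕ) :
    (angularPoly m α β).coeff k =
      if k < m + 1 then (-1) ^ k * jacobiCoeff m (-α - 1) (β - 1) k else 0 := by
  rw [angularPoly_eq_sum]
  simp only [finsetSum_coeff, coeff_C_mul, coeff_X_pow, mul_ite, mul_one, mul_zero,
    Finset.sum_ite_eq, Finset.mem_range]

/-- The hypergeometric recurrence, kept free of division so that it survives when `k + a + 1 = 0`.
-/
theorem jacobiCoeff_succ (n : ℕ) (a b : ℝ) (k : ℕ) (hk : k < n) :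
    (k + 1) * (k + a + 1) * jacobiCoeff n a b (k + 1) =
      (n - k) * (n + k + a + b + 1) * jacobiCoeff n a b k := by
  obtain ⟨j, rfl⟩ := Nat.exists_eq_add_of_lt hk
  have h1 : k + j + 1 - k = j + 1 := by omega
  have h2 : k + j + 1 - (k + 1) = j := by omega
  rw [jacobiCoeff, jacobiCoeff, h1, h2, ascPochhammer_succ_eval,
    ascPochhammer_succ_left, eval_mul, eval_X, eval_comp, Nat.factorial_succ, Nat.factorial_succ]
  have h3 : (X + 1 : ℝ[X]).eval (a + k + 1) = a + ((k + 1 : ℕ) : ℝ) + 1 := by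
    simp; ring
  rw [h3]
  have hk0 : (k.factorial : ℝ) ≠ 0 := by positivity
  have hj0 : (j.factorial : ℝ) ≠ 0 := by positivity
  push_cast
  field_simp
  ring

theorem angularPoly_coeff_succ (m : ℕ) (α β : ℝ) (k : ℕ) :
    (k + 1) * (k - α) * (angularPoly m α β).coeff (k + 1) +
      (m - k) * (m + k + β - α - 1) * (angularPoly m α β).coeff k = 0 := by
  rw [angularPoly_coeff, angularPoly_coeff]
  rcases lt_trichotomy k m with h | h | h
  · rw [if_pos (by omega), if_pos (by omega), pow_succ]
    linear_combination (-(-1) ^ k) * jacobiCoeff_succ m (-α - 1) (β - 1) k h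
  · subst h
    simp
  · rw [if_neg (by omega), if_neg (by omega)]
    simp

/-- The hypergeometric equation of the seed polynomial. -/
theorem angularPoly_ode (m : ℕ) (α β : ℝ) :
    X * (1 - X) * derivative (derivative (angularPoly m α β))
      + (C (-α) + C (α - β) * X) * derivative (angularPoly m α β)
      + C (m * (m + β - α - 1)) * angularPoly m α β = 0 := by
  set q := angularPoly m α β with hq
  have hrec := angularPoly_coeff_succ m α β
  rw [← hq] at hrec
  have e : X * (1 - X) * derivative (derivative q) + (C (-α) + C (α - β) * X) * derivative q
      + C (m * (m + β - α - 1)) * q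
      = X * derivative (derivative q) - X * (X * derivative (derivative q))
        + C (-α) * derivative q + C (α - β) * (X * derivative q)
        + C (m * (m + β - α - 1)) * q := by ring
  rw [e]
  ext k
  simp only [coeff_add, coeff_sub, coeff_C_mul, coeff_zero]
  rcases k with _ | _ | k
  · simp only [coeff_X_mul_zero, coeff_derivative]
    have := hrec 0
    push_cast at this ⊢
    linear_combination this
  · simp only [coeff_X_mul, coeff_X_mul_zero, coeff_derivative]
    have := hrec 1
    push_cast at this ⊢
    linear_combination this
  · simp only [coeff_X_mul, coeff_derivative]
    have := hrec (k + 2)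
    push_cast at this ⊢
    linear_combination this

/-- The top coefficient is, up to sign and a factorial, a Pochhammer symbol at `m + β - α - 1`,
which can vanish only if `α - β` is an integer. -/
theorem angularPoly_natDegree {α β : ℝ} (h : ∀ k : ℤ, α - β ≠ k) (m : ℕ) :
    (angularPoly m α β).coeff m ≠ 0 ∧ (angularPoly m α β).natDegree = m := by
  have hc : (angularPoly m α β).coeff m ≠ 0 := by
    rw [angularPoly_coeff, if_pos (by omega), jacobiCoeff]
    have hp : (ascPochhammer ℝ m).eval (m + (-α - 1) + (β - 1) + 1) ≠ 0 := by
      rw [Ne, ascPochhammer_eval_eq_zero_iff]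
      rintro ⟨k, _, hk⟩
      apply h (m - 1 + k)
      push_cast
      linear_combination -hk
    simp only [Nat.sub_self, ascPochhammer_zero, eval_one, Nat.factorial_zero]
    have : (m.factorial : ℝ) ≠ 0 := by positivity
    have : ((-1 : ℝ)) ^ m ≠ 0 := by simp
    positivity
  refine ⟨hc, le_antisymm ?_ (le_natDegree_of_ne_zero hc)⟩
  rw [natDegree_le_iff_coeff_eq_zero]
  intro k hk
  rw [angularPoly_coeff, if_neg (by omega)]

theorem angularPoly_ne_zero {α β : ℝ} (h : ∀ k : ℤ, α - β ≠ k) (m : ℕ) :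
    angularPoly m α β ≠ 0 := by
  intro h0
  have := (angularPoly_natDegree h m).1
  simp [h0] at this

/-! ### Riccati solutions of the sixth Painlevé equation and of SD-I.a -/

/-- The right-hand side of the Riccati equation `y (y - 1) u' = A u² + (B y + C) u + D y`. -/
def riccatiRhs (A B C D y u : ℝ) : ℝ := (A * u ^ 2 + (B * y + C) * u + D * y) / (y * (y - 1))

theorem deriv_deriv_of_riccati {A B C D y : ℝ} {u : ℝ → ℝ} (hy0 : y ≠ 0) (hy1 : y ≠ 1)
    (hu : ∀ᶠ z in 𝓝 y, HasDerivAt u (riccatiRhs A B C D z (u z)) z) :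
    deriv (deriv u) y =
      ((2 * A * u y * riccatiRhs A B C D y (u y) + B * u y
          + (B * y + C) * riccatiRhs A B C D y (u y) + D) * (y * (y - 1))
        - (A * u y ^ 2 + (B * y + C) * u y + D * y) * (2 * y - 1)) / (y * (y - 1)) ^ 2 := by
  have h1 : deriv u =ᶠ[𝓝 y] fun z => riccatiRhs A B C D z (u z) := hu.mono fun z hz => hz.deriv
  rw [h1.deriv_eq]
  have h0 := hu.self_of_nhds
  have hid := hasDerivAt_id' y
  have hn := (((h0.pow 2).const_mul A).add (((hid.const_mul B).add_const C).mul h0)).add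
    (hid.const_mul D)
  have hd := hid.mul (hid.sub_const 1)
  have hne : y * (y - 1) ≠ 0 := mul_ne_zero hy0 (sub_ne_zero.2 hy1)
  have h := hn.div hd hne
  refine (HasDerivAt.deriv h).trans ?_
  simp only [Pi.add_apply, Pi.mul_apply, Pi.pow_apply]
  congr 1
  push_cast
  ring

/-- Solutions of a Riccati equation with the right parameters solve the sixth Painlevé equation. -/
theorem isPVISolutionOn_of_riccati {A B C D : ℝ} (hs : A + B + C + D = 0) {u : ℝ → ℝ} {s : Set ℝ}
    (h : ∀ y ∈ s, y ≠ 0 ∧ y ≠ 1 ∧ AnalyticAt ℝ u y ∧ u y ≠ 0 ∧ u y ≠ 1 ∧ u y ≠ y ∧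
      ∀ᶠ z in 𝓝 y, HasDerivAt u (riccatiRhs A B C D z (u z)) z) :
    IsPVISolutionOn (A ^ 2 / 2) (-D ^ 2 / 2) ((A + C) ^ 2 / 2) ((1 - (A + B - 1) ^ 2) / 2) u s := by
  intro y hy
  obtain ⟨hy0, hy1, ha, hu0, hu1, huy, hr⟩ := h y hy
  refine ⟨hy0, hy1, ha, hu0, hu1, huy, ?_⟩
  rw [deriv_deriv_of_riccati hy0 hy1 hr, hr.self_of_nhds.deriv, riccatiRhs]
  -- The relation makes `u'` equal to `D/(y - 1)`, `-(A + C)/y` and `A + B` where `u` is `0`, `1`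
  -- and `y`. These values determine `γ₂`, `γ₃`, `γ₄`.
  obtain rfl : D = -A - B - C := by linear_combination hs
  have h1 : y - 1 ≠ 0 := sub_ne_zero.2 hy1
  have h2 : u y - 1 ≠ 0 := sub_ne_zero.2 hu1
  have h3 : u y - y ≠ 0 := sub_ne_zero.2 huy
  generalize u y = v at *
  field_simp
  ring

/-- As a function of `u`, the squared term has simple poles at `0`, `1`, `y` and linear growth. The
`γ` terms cancel the poles, and `(1 - t)²` with `t = A` cancels the growth, so the rest no longer
depends on `u`. -/
theorem cosgroveExpr_of_riccati {A B C D : ℝ} (hs : A + B + C + D = 0) {u : ℝ → ℝ} {y : ℝ}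
    (hy0 : y ≠ 0) (hy1 : y ≠ 1) (hu0 : u y ≠ 0) (hu1 : u y ≠ 1) (huy : u y ≠ y)
    (hr : HasDerivAt u (riccatiRhs A B C D y (u y)) y) :
    cosgroveExpr (-D ^ 2 / 2) ((A + C) ^ 2 / 2) ((1 - (A + B - 1) ^ 2) / 2) A u y =
      1 / 2 * (A - 1 + B / 2) * (A + C + B / 2) + B ^ 2 / 8 - B ^ 2 / 4 * y := by
  rw [cosgroveExpr, hr.deriv, riccatiRhs]
  obtain rfl : D = -A - B - C := by linear_combination hs
  have h1 : y - 1 ≠ 0 := sub_ne_zero.2 hy1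
  have h2 : u y - 1 ≠ 0 := sub_ne_zero.2 hu1
  have h3 : u y - y ≠ 0 := sub_ne_zero.2 huy
  generalize u y = v at *
  field_simp
  ring

/-- Passing to the other root of `2γ₁` brings `u` back. Applied with `t = A`, it yields the constant
`K` and the term `-A u` of `sdIa_of_riccati`. -/
theorem cosgroveExpr_neg (γ₂ γ₃ γ₄ t : ℝ) (u : ℝ → ℝ) (y : ℝ) :
    cosgroveExpr γ₂ γ₃ γ₄ (-t) u y = cosgroveExpr γ₂ γ₃ γ₄ t u y + t / 2 * (1 - 2 * u y) := by
  unfold cosgroveExpr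
  ring

/-- Functions with a Riccati equation give solutions of SD-I.a. -/
theorem sdIa_of_riccati {A B C D K y : ℝ} (hs : A + B + C + D = 0)
    (hK : K = A / 2 + 1 / 2 * (A - 1 + B / 2) * (A + C + B / 2) + B ^ 2 / 8)
    (hy0 : y ≠ 0) (hy1 : y ≠ 1) {u W : ℝ → ℝ}
    (hu : ∀ᶠ z in 𝓝 y, HasDerivAt u (riccatiRhs A B C D z (u z)) z)
    (hW : ∀ᶠ z in 𝓝 y, W z = K - B ^ 2 / 4 * z - A * u z) {a b μ : ℝ}
    (ha : a = C) (hb : b = A - D) (hμ : μ = B - 1) :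
    y ^ 2 * (1 - y) ^ 2 * deriv (deriv W) y ^ 2
      + 4 * deriv W y * (y * deriv W y - W y) ^ 2
      - 4 * deriv W y ^ 2 * (y * deriv W y - W y)
      + 4 * (-(1 + a ^ 2 + b ^ 2 + μ ^ 2) / 8) * deriv W y ^ 2
      + 4 * ((-1 - 2 * a ^ 2 - 6 * b ^ 2 + 2 * μ ^ 2 + 2 * a ^ 2 * b ^ 2 - 6 * a ^ 2 * μ ^ 2
          - 2 * b ^ 2 * μ ^ 2 - a ^ 4 - b ^ 4 - μ ^ 4) / 64) * deriv W y
      + 4 * ((a ^ 2 - b ^ 2) * (μ ^ 2 - 1) / 16) * (y * deriv W y - W y)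
      + 4 * (((a ^ 2 + b ^ 2) * (-1 + 2 * μ ^ 2 - μ ^ 4) - (a ^ 4 + b ^ 4) * (1 + μ ^ 2)
          + 2 * a ^ 2 * b ^ 2 * (1 + μ ^ 2)) / 128) = 0 := by
  have h1 : deriv W =ᶠ[𝓝 y] fun z => -B ^ 2 / 4 - A * deriv u z := by
    filter_upwards [hu, hW.eventually_nhds] with z hz hWz
    rw [EventuallyEq.deriv_eq (f := fun z => K - B ^ 2 / 4 * z - A * u z) hWz]
    have h := (((hasDerivAt_id' z).const_mul (B ^ 2 / 4)).const_sub K).sub (hz.const_mul A)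
    refine h.deriv.trans ?_
    rw [hz.deriv]
    ring
  have hud : deriv u =ᶠ[𝓝 y] fun z => riccatiRhs A B C D z (u z) := hu.mono fun z hz => hz.deriv
  have hdd : DifferentiableAt ℝ (deriv u) y := by
    refine DifferentiableAt.congr_of_eventuallyEq ?_ hud
    have hu0 := hu.self_of_nhds.differentiableAt
    have : y * (y - 1) ≠ 0 := mul_ne_zero hy0 (sub_ne_zero.2 hy1)
    unfold riccatiRhs
    fun_prop (disch := assumption)
  have h2 : deriv (deriv W) y = -A * deriv (deriv u) y := by
    rw [h1.deriv_eq]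
    have h := (hdd.hasDerivAt.const_mul A).const_sub (-B ^ 2 / 4)
    refine h.deriv.trans ?_
    ring
  have h3 : deriv W y = -B ^ 2 / 4 - A * deriv u y := h1.self_of_nhds
  rw [h2, h3, hW.self_of_nhds, deriv_deriv_of_riccati hy0 hy1 hu,
    hu.self_of_nhds.deriv, riccatiRhs]
  -- All derivatives are now expressed through `u y`, and the equation is a rational identity in `y`
  -- and the value of `u`.
  obtain rfl : D = -A - B - C := by linear_combination hs
  subst ha hb hμ hK
  have h4 : y - 1 ≠ 0 := sub_ne_zero.2 hy1
  generalize u y = v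
  field_simp
  ring

/-! ### The Riccati function of the seed polynomial and the function `W` -/

/-- The numerator of the Riccati function of the seed polynomial. -/
def riccatiNum (m : ℕ) (α β : ℝ) : ℝ[X] :=
  C (1 / (m + 1 : ℝ)) * ((C (1 + α) + C (m + β - α - 1) * X) * angularPoly m α β
    - X * (1 - X) * derivative (angularPoly m α β))

/-- The classical solution of the sixth Painlevé equation given by the seed polynomial. -/
def riccatiFun (m : ℕ) (α β y : ℝ) : ℝ :=
  (riccatiNum m α β).eval y / (angularPoly m α β).eval y

theorem riccatiNum_eval (m : ℕ) (α β y : ℝ) :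
    (riccatiNum m α β).eval y = ((1 + α + (m + β - α - 1) * y) * (angularPoly m α β).eval y
      - y * (1 - y) * (derivative (angularPoly m α β)).eval y) / (m + 1) := by
  simp [riccatiNum]
  ring

theorem angularPoly_ode_eval (m : ℕ) (α β y : ℝ) :
    y * (1 - y) * (derivative (derivative (angularPoly m α β))).eval y
      + (-α + (α - β) * y) * (derivative (angularPoly m α β)).eval y
      + m * (m + β - α - 1) * (angularPoly m α β).eval y = 0 := by
  have h := congrArg (Polynomial.eval y) (angularPoly_ode m α β)
  simpa only [eval_add, eval_mul, eval_sub, eval_X, eval_one, eval_C, eval_zero] using h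

theorem hasDerivAt_riccatiFun {m : ℕ} {α β y : ℝ} (hy0 : y ≠ 0) (hy1 : y ≠ 1)
    (hq : (angularPoly m α β).eval y ≠ 0) :
    HasDerivAt (riccatiFun m α β) (riccatiRhs (-(m + 1)) (2 * m + β - α) (1 + α) (-m - β) y
      (riccatiFun m α β y)) y := by
  have h := ((riccatiNum m α β).hasDerivAt y).div ((angularPoly m α β).hasDerivAt y) hq
  refine HasDerivAt.congr_deriv h ?_
  have hode := angularPoly_ode_eval m α β y
  have hm : (m + 1 : ℝ) ≠ 0 := by positivity
  have hy : y - 1 ≠ 0 := sub_ne_zero.2 hy1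
  have hd : (derivative (riccatiNum m α β)).eval y =
      ((m + β - α - 1) * (angularPoly m α β).eval y
        + (1 + α + (m + β - α - 1) * y) * (derivative (angularPoly m α β)).eval y
      - ((1 - 2 * y) * (derivative (angularPoly m α β)).eval y
        + y * (1 - y) * (derivative (derivative (angularPoly m α β))).eval y)) / (m + 1) := by
    simp [riccatiNum]
    ring
  rw [riccatiRhs, riccatiFun, riccatiNum_eval, hd]
  generalize (angularPoly m α β).eval y = q at *
  generalize (derivative (angularPoly m α β)).eval y = q' at *
  generalize (derivative (derivative (angularPoly m α β))).eval y = q'' at *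
  obtain rfl | h0 := eq_or_ne y 0
  · exact absurd rfl hy0
  field_simp
  linear_combination (-(y * (y - 1) * q)) * hode

theorem analyticAt_eval_div {p q : ℝ[X]} {y : ℝ} (hq : q.eval y ≠ 0) :
    AnalyticAt ℝ (fun z => p.eval z / q.eval z) y := by
  refine AnalyticAt.div ?_ ?_ hq
  · exact AnalyticOnNhd.eval_polynomial p y trivial
  · exact AnalyticOnNhd.eval_polynomial q y trivial

theorem eventually_eval_ne_zero {q : ℝ[X]} {y : ℝ} (hq : q.eval y ≠ 0) :
    ∀ᶠ z in 𝓝 y, q.eval z ≠ 0 :=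
  q.continuous.continuousAt.eventually_ne hq

theorem eventually_hasDerivAt_riccatiFun {m : ℕ} {α β y : ℝ} (hy0 : y ≠ 0) (hy1 : y ≠ 1)
    (hq : (angularPoly m α β).eval y ≠ 0) :
    ∀ᶠ z in 𝓝 y, HasDerivAt (riccatiFun m α β) (riccatiRhs (-(m + 1)) (2 * m + β - α) (1 + α)
      (-m - β) z (riccatiFun m α β z)) z := by
  filter_upwards [eventually_ne_nhds hy0, eventually_ne_nhds hy1, eventually_eval_ne_zero hq]
    with z h0 h1 h2 using hasDerivAt_riccatiFun h0 h1 h2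

/-- The constant term of the linear part of Cosgrove's function. -/
def linearConst (m : ℕ) (α β : ℝ) : ℝ :=
  -(m + 1) / 2 + 1 / 2 * (-(m + 1) - 1 + (2 * m + β - α) / 2)
    * (-(m + 1) + (1 + α) + (2 * m + β - α) / 2) + (2 * m + β - α) ^ 2 / 8

/-- The numerator of Cosgrove's function. -/
def cosgroveNum (m : ℕ) (α β : ℝ) : ℝ[X] :=
  (C (linearConst m α β) - C ((2 * m + β - α) ^ 2 / 4) * X) * angularPoly m α β
    + C (m + 1 : ℝ) * riccatiNum m α β

/-- The solution `W` of SD-I.a that gives the potential. -/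
def cosgroveFun (m : ℕ) (α β y : ℝ) : ℝ :=
  (cosgroveNum m α β).eval y / (angularPoly m α β).eval y

theorem cosgroveFun_eq {m : ℕ} {α β y : ℝ} (hq : (angularPoly m α β).eval y ≠ 0) :
    cosgroveFun m α β y = linearConst m α β - (2 * m + β - α) ^ 2 / 4 * y
      - -(m + 1) * riccatiFun m α β y := by
  rw [cosgroveFun, cosgroveNum, riccatiFun]
  simp only [eval_add, eval_mul, eval_sub, eval_X, eval_C]
  field_simp
  ring

theorem hasDerivAt_cosgroveFun {m : ℕ} {α β y : ℝ} (hy0 : y ≠ 0) (hy1 : y ≠ 1)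
    (hq : (angularPoly m α β).eval y ≠ 0) :
    HasDerivAt (cosgroveFun m α β) (-((2 * m + β - α) ^ 2 / 4)
      + (m + 1) * riccatiRhs (-(m + 1)) (2 * m + β - α) (1 + α) (-m - β) y
        (riccatiFun m α β y)) y := by
  have hu := hasDerivAt_riccatiFun hy0 hy1 hq
  have h := (((hasDerivAt_id' y).const_mul ((2 * m + β - α) ^ 2 / 4)).const_sub
    (linearConst m α β)).sub (hu.const_mul (-(m + 1 : ℝ)))
  refine (h.congr_of_eventuallyEq ?_).congr_deriv (by ring)
  filter_upwards [eventually_eval_ne_zero hq] with z hz using cosgroveFun_eq hz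

theorem isSDIaSolutionOn_cosgroveFun (m : ℕ) (α β : ℝ) :
    ∃ q₇ q₈ q₉ q₁₀ : ℝ,
      IsSDIaSolutionOn q₇ q₈ q₉ q₁₀ (cosgroveFun m α β) (regularPoints m α β) := by
  -- The constants are those of `sdIa_of_riccati` with `a = 1 + α`, `b = β - 1`, `μ = 2m - α + β -
  -- 1`: up to sign the two Jacobi parameters and the square root of the seed eigenvalue.
  refine ⟨_, _, _, _, fun y hy => ⟨?_, sdIa_of_riccati (A := -(m + 1)) (B := 2 * m + β - α)
    (C := 1 + α) (D := -m - β) (K := linearConst m α β) (by ring) ?_ ?_ ?_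
    (eventually_hasDerivAt_riccatiFun ?_ ?_ ?_) ?_ rfl rfl rfl⟩⟩
  · exact analyticAt_eval_div (by rw [angularPoly_eval]; exact hy.2.2)
  · rw [linearConst]
  · exact hy.1.ne'
  · exact hy.2.1.ne
  · exact hy.1.ne'
  · exact hy.2.1.ne
  · rw [angularPoly_eval]; exact hy.2.2
  · have : (angularPoly m α β).eval y ≠ 0 := by rw [angularPoly_eval]; exact hy.2.2
    filter_upwards [eventually_eval_ne_zero this] with z hz using cosgroveFun_eq hz

/-! ### The representation by the sixth Painlevé equation -/

/-- On `s`, up to a finite set, `W` is given by Cosgrove's expression of a solution of the sixth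
Painlevé equation. -/
def HasPVIRepresentation (W : ℝ → ℝ) (s : Set ℝ) : Prop :=
  ∃ (γ₁ γ₂ γ₃ γ₄ t : ℝ) (u : ℝ → ℝ) (S : Set ℝ), t ^ 2 = 2 * γ₁ ∧ S.Finite ∧
    IsPVISolutionOn γ₁ γ₂ γ₃ γ₄ u (s \ S) ∧ ∀ y ∈ s \ S, W y = cosgroveExpr γ₂ γ₃ γ₄ t u y

/-- Linear functions of nonpositive slope come from linear solutions of the sixth Painlevé
equation. -/
theorem hasPVIRepresentation_of_linear {W : ℝ → ℝ} {s : Set ℝ} {k b : ℝ}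
    (hs : ∀ y ∈ s, 0 < y ∧ y < 1) (hW : ∀ y ∈ s, W y = k - b ^ 2 / 4 * y) :
    HasPVIRepresentation W s := by
  -- Only `b²` matters. The nonpositive root avoids `B = 1` and `B = 2`, where `u` could be
  -- identically `0`, `1` or `y`, and `B = 4`, where `c` could not be solved for.
  obtain ⟨B, hB, hb⟩ : ∃ B : ℝ, B ≤ 0 ∧ B ^ 2 = b ^ 2 :=
    ⟨-|b|, by simp, by simp⟩
  have hB1 : B - 1 ≠ 0 := by linarith
  have hB2 : B - 2 ≠ 0 := by linarith
  have hB4 : B - 4 ≠ 0 := by linarith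
  obtain ⟨c, hc⟩ : ∃ c : ℝ, k = 1 / 2 * (-1 - 1 + B / 2) * (-1 + c + B / 2) + B ^ 2 / 8 :=
    ⟨1 - B / 2 + 4 * (k - B ^ 2 / 8) / (B - 4), by field_simp; ring⟩
  have hlin : ∀ y : ℝ, HasDerivAt (fun y : ℝ => c + (B - 1) * y) (B - 1) y := fun y => by
    simpa using ((hasDerivAt_id' y).const_mul (B - 1)).const_add c
  -- With `A = -1` and `u = c + (B - 1) y`, the factor `-u + B y + c` is `y`, so the right-hand side
  -- is divisible by `y`.
  have hric : ∀ y : ℝ, y ≠ 0 → y ≠ 1 → HasDerivAt (fun y : ℝ => c + (B - 1) * y)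
      (riccatiRhs (-1) B c (1 - B - c) y (c + (B - 1) * y)) y := by
    intro y hy0 hy1
    refine (hlin y).congr_deriv ?_
    have : y - 1 ≠ 0 := sub_ne_zero.2 hy1
    rw [riccatiRhs]
    field_simp
    ring
  have key : ∀ y ∈ s \ {-c / (B - 1), (1 - c) / (B - 1), -c / (B - 2)},
      y ≠ 0 ∧ y ≠ 1 ∧ c + (B - 1) * y ≠ 0 ∧ c + (B - 1) * y ≠ 1 ∧ c + (B - 1) * y ≠ y := by
    rintro y ⟨hy, hyS⟩
    simp only [Set.mem_insert_iff, Set.mem_singleton_iff, not_or] at hyS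
    refine ⟨(hs y hy).1.ne', (hs y hy).2.ne, fun h => hyS.1 ?_, fun h => hyS.2.1 ?_,
      fun h => hyS.2.2 ?_⟩
    · rw [eq_div_iff hB1]; linear_combination h
    · rw [eq_div_iff hB1]; linear_combination h
    · rw [eq_div_iff hB2]; linear_combination h
  have hsum : (-1 : ℝ) + B + c + (1 - B - c) = 0 := by ring
  refine ⟨_, _, _, _, -1, fun y => c + (B - 1) * y, _, by norm_num, Set.toFinite _,
    isPVISolutionOn_of_riccati hsum (s := s \ {-c / (B - 1), (1 - c) / (B - 1), -c / (B - 2)})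
      fun y hy => ?_, fun y hy => ?_⟩
  · obtain ⟨h0, h1, h2, h3, h4⟩ := key y hy
    refine ⟨h0, h1, by fun_prop, h2, h3, h4, ?_⟩
    filter_upwards [eventually_ne_nhds h0, eventually_ne_nhds h1] with z hz0 hz1
      using hric z hz0 hz1
  · obtain ⟨h0, h1, h2, h3, h4⟩ := key y hy
    rw [cosgroveExpr_of_riccati hsum h0 h1 h2 h3 h4 (hric y h0 h1), hW y hy.1, hb.symm, hc]

/-- If the logarithmic derivative of the seed polynomial is a linear function divided by
`y (1 - y)`, then its slope is an exponent of the hypergeometric equation at infinity. -/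
theorem slope_eq_of_logDeriv_linear {m : ℕ} {α β a₀ a₁ : ℝ} (hq : angularPoly m α β ≠ 0)
    (h : X * (1 - X) * derivative (angularPoly m α β) = (C a₀ + C a₁ * X) * angularPoly m α β) :
    a₁ ^ 2 + (1 + α - β) * a₁ = m * (m + β - α - 1) := by
  have hode := angularPoly_ode m α β
  set q := angularPoly m α β
  have hd := congrArg derivative h
  simp only [derivative_mul, derivative_sub, derivative_add, derivative_X, derivative_one,
    derivative_C, zero_mul, zero_add, zero_sub, mul_one, one_mul] at hd
  have h2 : ((1 - C 2 * X - (C a₀ + C a₁ * X) - (C (-α) + C (α - β) * X)) * (C a₀ + C a₁ * X)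
      - (C a₁ + C (m * (m + β - α - 1))) * (X * (1 - X))) * q = 0 := by
    have hC : (C 2 : ℝ[X]) = 2 := rfl
    rw [hC]
    linear_combination X * (1 - X) * hd - X * (1 - X) * hode
      - (1 - 2 * X - (C a₀ + C a₁ * X) - (C (-α) + C (α - β) * X)) * h
  have h3 := (mul_eq_zero.1 h2).resolve_right hq
  -- The values at `0`, `1`, `-1` isolate the `X²` coefficient of the quadratic factor.
  have e0 := congrArg (Polynomial.eval 0) h3
  have e1 := congrArg (Polynomial.eval 1) h3
  have e2 := congrArg (Polynomial.eval (-1)) h3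
  simp only [eval_add, eval_mul, eval_sub, eval_X, eval_one, eval_C, eval_zero] at e0 e1 e2
  linear_combination e0 - (e1 + e2) / 2

/-- The slope relation turns the slope of `W` into minus a square, `-(2 + α - β + 2 a₁)²/4`, as the
linear case requires. -/
theorem hasPVIRepresentation_of_logDeriv_linear {m : ℕ} {α β a₀ a₁ : ℝ}
    (hq : angularPoly m α β ≠ 0)
    (h : X * (1 - X) * derivative (angularPoly m α β) = (C a₀ + C a₁ * X) * angularPoly m α β) :
    HasPVIRepresentation (cosgroveFun m α β) (regularPoints m α β) := by
  have hslope := slope_eq_of_logDeriv_linear hq h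
  refine hasPVIRepresentation_of_linear (k := linearConst m α β + (1 + α) - a₀)
    (b := 2 + α - β + 2 * a₁) (fun y hy => ⟨hy.1, hy.2.1⟩) fun y hy => ?_
  have hqy : (angularPoly m α β).eval y ≠ 0 := by rw [angularPoly_eval]; exact hy.2.2
  have hy := congrArg (Polynomial.eval y) h
  simp only [eval_add, eval_mul, eval_sub, eval_X, eval_one, eval_C] at hy
  rw [cosgroveFun_eq hqy, riccatiFun, riccatiNum_eval, hy]
  have hm : (m + 1 : ℝ) ≠ 0 := by positivity
  field_simp
  linear_combination (4 * y) * hslope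

theorem finite_zeros {p : ℝ[X]} (hp : p ≠ 0) : {y | p.eval y = 0}.Finite :=
  p.roots.toFinset.finite_toSet.subset fun y hy => by
    simpa only [Finset.mem_coe, Multiset.mem_toFinset] using (mem_roots hp).2 hy

theorem hasPVIRepresentation_cosgroveFun {m : ℕ} {α β : ℝ} (hq : angularPoly m α β ≠ 0) :
    HasPVIRepresentation (cosgroveFun m α β) (regularPoints m α β) := by
  have hm : (m + 1 : ℝ) ≠ 0 := by positivity
  have hU : C (m + 1 : ℝ) * riccatiNum m α β =
      (C (1 + α) + C (m + β - α - 1) * X) * angularPoly m α β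
        - X * (1 - X) * derivative (angularPoly m α β) := by
    rw [riccatiNum, ← mul_assoc, ← C_mul, mul_one_div_cancel hm, C_1, one_mul]
  -- The degenerate cases `u ≡ 0`, `u ≡ 1`, `u ≡ y`: in each, `y (1 - y) q'/q` is affine in `y`.
  by_cases h0 : riccatiNum m α β = 0
  · refine hasPVIRepresentation_of_logDeriv_linear hq (a₀ := 1 + α) (a₁ := m + β - α - 1) ?_
    rw [h0] at hU
    linear_combination hU
  by_cases h1 : riccatiNum m α β - angularPoly m α β = 0
  · refine hasPVIRepresentation_of_logDeriv_linear hq (a₀ := 1 + α - (m + 1))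
      (a₁ := m + β - α - 1) ?_
    rw [C_sub (a := 1 + α)]
    linear_combination hU - C (m + 1 : ℝ) * h1
  by_cases h2 : riccatiNum m α β - X * angularPoly m α β = 0
  · refine hasPVIRepresentation_of_logDeriv_linear hq (a₀ := 1 + α)
      (a₁ := m + β - α - 1 - (m + 1)) ?_
    rw [C_sub (a := m + β - α - 1)]
    linear_combination hU - C (m + 1 : ℝ) * h2
  set S : Set ℝ := {y | (riccatiNum m α β * (riccatiNum m α β - angularPoly m α β)
    * (riccatiNum m α β - X * angularPoly m α β)).eval y = 0} with hS
  have hfin : S.Finite := finite_zeros (mul_ne_zero (mul_ne_zero h0 h1) h2)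
  have hsum : -(m + 1 : ℝ) + (2 * m + β - α) + (1 + α) + (-m - β) = 0 := by ring
  have key : ∀ y ∈ regularPoints m α β \ S, y ≠ 0 ∧ y ≠ 1 ∧ (angularPoly m α β).eval y ≠ 0 ∧
      riccatiFun m α β y ≠ 0 ∧ riccatiFun m α β y ≠ 1 ∧ riccatiFun m α β y ≠ y := by
    rintro y ⟨hy, hyS⟩
    have hqy : (angularPoly m α β).eval y ≠ 0 := by rw [angularPoly_eval]; exact hy.2.2
    simp only [hS, Set.mem_ofPred_eq, eval_mul, eval_sub, eval_X, mul_eq_zero, not_or] at hyS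
    refine ⟨hy.1.ne', hy.2.1.ne, hqy, div_ne_zero hyS.1.1 hqy, fun h => hyS.1.2 ?_,
      fun h => hyS.2 ?_⟩
    · rw [riccatiFun, div_eq_iff hqy] at h
      linear_combination h
    · rw [riccatiFun, div_eq_iff hqy] at h
      linear_combination h
  -- The root `t = -A = m + 1` is needed, because `t = A` would lose the `u` term of `W`.
  refine ⟨_, _, _, _, -(-(m + 1)), riccatiFun m α β, S, by ring, hfin,
    isPVISolutionOn_of_riccati hsum fun y hy => ?_, fun y hy => ?_⟩
  · obtain ⟨hy0, hy1, hqy, hu0, hu1, huy⟩ := key y hy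
    exact ⟨hy0, hy1, analyticAt_eval_div hqy, hu0, hu1, huy,
      eventually_hasDerivAt_riccatiFun hy0 hy1 hqy⟩
  · obtain ⟨hy0, hy1, hqy, hu0, hu1, huy⟩ := key y hy
    rw [cosgroveExpr_neg, cosgroveExpr_of_riccati hsum hy0 hy1 hu0 hu1 huy
      (hasDerivAt_riccatiFun hy0 hy1 hqy), cosgroveFun_eq hqy, linearConst]
    ring

/-! ### The superpotential, the Hamiltonian and the potential -/

theorem superpotential_eq {m : ℕ} {α β x : ℝ} (h0 : -1 < x) (h1 : x < 1)
    (hP : (seedPoly m α β).eval x ≠ 0) :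
    superpotential m α β x = -((β / 2 - 1 / 4) / (1 + x) + (α / 2 + 1 / 4) / (1 - x)
      + (derivative (seedPoly m α β)).eval x / (seedPoly m α β).eval x) := by
  have hp : 0 < 1 + x := by linarith
  have hn : 0 < 1 - x := by linarith
  have d1 := ((hasDerivAt_id' x).const_add 1).rpow_const (p := β / 2 - 1 / 4) (Or.inl hp.ne')
  have d2 := ((hasDerivAt_id' x).const_sub 1).rpow_const (p := -α / 2 - 1 / 4) (Or.inl hn.ne')
  have d := (d1.mul d2).mul ((seedPoly m α β).hasDerivAt x)
  have hd : deriv (seed m α β) x = _ := d.deriv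
  rw [superpotential, logDeriv_apply, hd]
  simp only [seed, Pi.mul_apply]
  rw [Real.rpow_sub_one hp.ne', Real.rpow_sub_one hn.ne']
  have e1 : (1 + x) ^ (β / 2 - 1 / 4) ≠ 0 := (Real.rpow_pos_of_pos hp _).ne'
  have e2 : (1 - x) ^ (-α / 2 - 1 / 4) ≠ 0 := (Real.rpow_pos_of_pos hn _).ne'
  field_simp
  ring

theorem superpotential_eq_riccati {m : ℕ} {α β x : ℝ} (h0 : -1 < x) (h1 : x < 1)
    (hP : (seedPoly m α β).eval x ≠ 0) :
    superpotential m α β x = -((β - 1 / 2) * ((1 - x) / 2) + (α + 1 / 2) * (1 - (1 - x) / 2)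
      - 2 * (1 + α + (m + β - α - 1) * ((1 - x) / 2)
        - (m + 1) * riccatiFun m α β ((1 - x) / 2)))
      / (4 * ((1 - x) / 2) * (1 - (1 - x) / 2)) := by
  rw [superpotential_eq h0 h1 hP, riccatiFun, riccatiNum_eval, angularPoly_eval]
  have e : 1 - 2 * ((1 - x) / 2) = x := by ring
  have hd : (derivative (angularPoly m α β)).eval ((1 - x) / 2) =
      -2 * (derivative (seedPoly m α β)).eval x := by
    rw [angularPoly, derivative_comp]
    simp [e]
  rw [e, hd]
  have hp : 1 + x ≠ 0 := by linarith
  have hn : 1 - x ≠ 0 := by linarith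
  have hm : (m + 1 : ℝ) ≠ 0 := by positivity
  have e2 : 1 - (1 - x) / 2 = (1 + x) / 2 := by ring
  rw [e2]
  field_simp
  ring

theorem hasDerivAt_superpotential {m : ℕ} {α β x y : ℝ} (h0 : -1 < x) (h1 : x < 1)
    (hP : (seedPoly m α β).eval x ≠ 0) (hy : y = (1 - x) / 2) :
    HasDerivAt (superpotential m α β)
      ((((β - 1 / 2) / 2 - (α + 1 / 2) / 2 - (m + β - α - 1)
        + (m + 1) * riccatiRhs (-(m + 1)) (2 * m + β - α) (1 + α) (-m - β) y (riccatiFun m α β y))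
        * (4 * y * (1 - y))
      - ((β - 1 / 2) * y + (α + 1 / 2) * (1 - y)
        - 2 * (1 + α + (m + β - α - 1) * y - (m + 1) * riccatiFun m α β y)) * (2 - 4 * y))
        / (4 * y * (1 - y)) ^ 2) x := by
  have hy0 : y ≠ 0 := by rw [hy]; linarith
  have hy1 : y ≠ 1 := by rw [hy]; linarith
  have hq : (angularPoly m α β).eval y ≠ 0 := by
    rw [angularPoly_eval, hy]; convert hP using 2; ring
  have hdy : HasDerivAt (fun z : ℝ => (1 - z) / 2) (-1 / 2) x :=
    ((hasDerivAt_id' x).const_sub 1).div_const 2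
  have hu := hasDerivAt_riccatiFun hy0 hy1 hq
  rw [hy] at hu
  have hu' := hu.comp x hdy
  have hn := (((hdy.const_mul (β - 1 / 2)).add ((hdy.const_sub 1).const_mul (α + 1 / 2))).sub
    ((((hdy.const_mul (m + β - α - 1)).const_add (1 + α)).sub
      (hu'.const_mul (m + 1 : ℝ))).const_mul 2)).neg
  have hd := (hdy.const_mul 4).mul (hdy.const_sub 1)
  have hne : 4 * ((1 - x) / 2) * (1 - (1 - x) / 2) ≠ 0 := by
    rw [← hy]; exact mul_ne_zero (mul_ne_zero four_ne_zero hy0) (sub_ne_zero.2 hy1.symm)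
  have h := hn.div hd hne
  refine (h.congr_of_eventuallyEq ?_).congr_deriv ?_
  · filter_upwards [eventually_gt_nhds h0, eventually_lt_nhds h1, eventually_eval_ne_zero hP]
      with z hz0 hz1 hzP using superpotential_eq_riccati hz0 hz1 hzP
  · simp only [Pi.add_apply, Pi.mul_apply, Pi.sub_apply, Pi.neg_apply, Function.comp_apply, ← hy]
    congr 1
    ring

/-- The angular part of the potential. -/
def angularPotential (m : ℕ) (α β x : ℝ) : ℝ :=
  2 * (1 - x ^ 2) * (deriv (superpotential m α β) x + superpotential m α β x ^ 2)
    - 2 * x * superpotential m α β x + (2 * m - α + β - 1) ^ 2 / 2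

/-- The Riccati equation removes `u'` from both sides, leaving an identity in `u` and `y`. It holds
because of the particular values of `linearConst` and `cotCoeff`. -/
theorem angularPotential_eq {m : ℕ} {α β x y : ℝ} (h0 : -1 < x) (h1 : x < 1)
    (hP : (seedPoly m α β).eval x ≠ 0) (hy : y = (1 - x) / 2) :
    angularPotential m α β x = 4 * deriv (cosgroveFun m α β) y
      + (2 * cosgroveFun m α β y * (2 * y - 1) + cotCoeff m α β / 2) / (y * (1 - y)) := by
  have hy0 : y ≠ 0 := by rw [hy]; linarith
  have hy1 : y ≠ 1 := by rw [hy]; linarith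
  have hq : (angularPoly m α β).eval y ≠ 0 := by
    rw [angularPoly_eval, hy]; convert hP using 2; ring
  rw [angularPotential, (hasDerivAt_superpotential h0 h1 hP hy).deriv,
    superpotential_eq_riccati h0 h1 hP, ← hy, (hasDerivAt_cosgroveFun hy0 hy1 hq).deriv,
    cosgroveFun_eq hq]
  obtain rfl : x = 1 - 2 * y := by rw [hy]; ring
  rw [riccatiRhs, linearConst, cotCoeff]
  generalize riccatiFun m α β y = u
  have h3 : y - 1 ≠ 0 := sub_ne_zero.2 hy1
  have h4 : 1 - y ≠ 0 := sub_ne_zero.2 hy1.symm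
  obtain ⟨z, hz⟩ : ∃ z, z = 1 - y := ⟨_, rfl⟩
  have hz' : y - 1 = -z := by rw [hz]; ring
  rw [← hz, hz']
  rw [← hz] at h4
  field_simp
  rw [hz]
  ring

/-- In the expansion of `A A†` the terms superpotential times `f'` cancel, and `s s' = -x` for `s =
√(1 - x²)` produces the remaining lower-order terms. -/
theorem angularOp_eq {m : ℕ} {α β x : ℝ} (h0 : -1 < x) (h1 : x < 1)
    (hP : (seedPoly m α β).eval x ≠ 0) {f : ℝ → ℝ} (hf : DifferentiableAt ℝ f x)
    (hf' : DifferentiableAt ℝ (deriv f) x) :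
    angularOp m α β f x = -4 * (1 - x ^ 2) * deriv (deriv f) x + 4 * x * deriv f x
      + 2 * angularPotential m α β x * f x := by
  have hpos : 0 < 1 - x ^ 2 := by nlinarith
  have hw := (hasDerivAt_superpotential h0 h1 hP rfl).differentiableAt.hasDerivAt
  have hs := (((hasDerivAt_id' x).pow 2).const_sub 1).sqrt hpos.ne'
  have hd := (hs.const_mul 2).mul (hf'.hasDerivAt.neg.add (hw.mul hf.hasDerivAt))
  have hd' : deriv (opAdag m α β f) x = _ := hd.deriv
  rw [angularOp, opA, hd', opAdag, angularPotential]
  simp only [Pi.mul_apply, Pi.add_apply, Pi.neg_apply, Pi.pow_apply]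
  have hsq : √(1 - x ^ 2) ^ 2 = 1 - x ^ 2 := Real.sq_sqrt hpos.le
  have hne : √(1 - x ^ 2) ≠ 0 := (Real.sqrt_pos.2 hpos).ne'
  generalize √(1 - x ^ 2) = v at *
  rw [← hsq]
  field_simp
  push_cast
  ring

theorem angle_bounds {θ : ℝ} (h0 : 0 < θ) (h1 : θ < Real.pi / 2) :
    -1 < -Real.cos (2 * θ) ∧ -Real.cos (2 * θ) < 1 := by
  have hs : 0 < Real.sin (2 * θ) := Real.sin_pos_of_pos_of_lt_pi (by linarith) (by linarith)
  have h := Real.sin_sq_add_cos_sq (2 * θ)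
  have : 0 < Real.sin (2 * θ) ^ 2 := by positivity
  constructor <;> nlinarith

theorem potential_eq {m : ℕ} {α β ω r θ : ℝ} (hθ : θ ∈ regularAngles m α β) :
    potential ω m α β r θ = ω ^ 2 * r ^ 2 / 2
      + 1 / r ^ 2 * angularPotential m α β (-Real.cos (2 * θ)) := by
  obtain ⟨hb0, hb1⟩ := angle_bounds hθ.1 hθ.2.1
  rw [potential, hamiltonian, angularOp_eq hb0 hb1 hθ.2.2 (by fun_prop) (by simp)]
  simp only [deriv_const', mul_zero]
  ring

theorem differentiableAt_of_contDiffAt_two {g : ℝ → ℝ} {x : ℝ} (hg : ContDiffAt ℝ 2 g x) :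
    (∀ᶠ z in 𝓝 x, DifferentiableAt ℝ g z) ∧ DifferentiableAt ℝ (deriv g) x := by
  refine ⟨(hg.eventually (by simp)).mono fun z hz => hz.differentiableAt (by simp), ?_⟩
  have h : ContDiffAt ℝ 1 (fderiv ℝ g) x := hg.fderiv_right (by norm_num)
  have h' : DifferentiableAt ℝ (fun z => fderiv ℝ g z 1) x :=
    (h.differentiableAt (by simp)).clm_apply (differentiableAt_const _)
  exact h'

/-- For `x = -cos 2θ` the chain rule gives `∂_θ² = 4 (1 - x²) ∂_x² - 4 x ∂_x`, which is minus the
differential part of the angular operator. -/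
theorem hamiltonian_eq {m : ℕ} {α β ω r θ : ℝ} {Ψ : ℝ → ℝ → ℝ} (hr : 0 < r)
    (hθ : θ ∈ regularAngles m α β)
    (hΨ : ContDiffAt ℝ 2 (fun p : ℝ × ℝ => Ψ p.1 p.2) (r, -Real.cos (2 * θ))) :
    hamiltonian ω m α β Ψ r (-Real.cos (2 * θ)) =
      -(1 / 2) * polarLaplacian (fun s t => Ψ s (-Real.cos (2 * t))) r θ
        + potential ω m α β r θ * Ψ r (-Real.cos (2 * θ)) := by
  obtain ⟨hb0, hb1⟩ := angle_bounds hθ.1 hθ.2.1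
  have hg : ContDiffAt ℝ 2 (Ψ r) (-Real.cos (2 * θ)) :=
    hΨ.comp (f := fun x : ℝ => (r, x)) _ (contDiffAt_const.prodMk contDiffAt_id)
  have hh : ContDiffAt ℝ 2 (fun s => Ψ s (-Real.cos (2 * θ))) r :=
    hΨ.comp (f := fun s : ℝ => (s, -Real.cos (2 * θ))) _ (contDiffAt_id.prodMk contDiffAt_const)
  obtain ⟨hg1, hg2⟩ := differentiableAt_of_contDiffAt_two hg
  obtain ⟨-, hh2⟩ := differentiableAt_of_contDiffAt_two hh
  have hrad : deriv (fun ρ => ρ * deriv (fun s => Ψ s (-Real.cos (2 * θ))) ρ) r =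
      deriv (fun s => Ψ s (-Real.cos (2 * θ))) r
        + r * deriv (deriv fun s => Ψ s (-Real.cos (2 * θ))) r := by
    refine ((hasDerivAt_id' r).mul hh2.hasDerivAt).deriv.trans ?_
    simp
  have hc : ∀ t : ℝ, HasDerivAt (fun t : ℝ => -Real.cos (2 * t)) (2 * Real.sin (2 * t)) t := by
    intro t
    have h := (((hasDerivAt_id' t).const_mul 2).cos).neg
    exact h.congr_deriv (by ring)
  have hsin : HasDerivAt (fun t : ℝ => 2 * Real.sin (2 * t)) (4 * Real.cos (2 * θ)) θ := by
    have h := (((hasDerivAt_id' θ).const_mul 2).sin).const_mul 2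
    exact h.congr_deriv (by ring)
  have hang1 : deriv (fun t => Ψ r (-Real.cos (2 * t))) =ᶠ[𝓝 θ]
      fun t => deriv (Ψ r) (-Real.cos (2 * t)) * (2 * Real.sin (2 * t)) := by
    filter_upwards [(hc θ).continuousAt.eventually hg1] with t ht
    exact (ht.hasDerivAt.comp t (hc t)).deriv
  have hang : deriv (deriv fun t => Ψ r (-Real.cos (2 * t))) θ =
      4 * (1 - Real.cos (2 * θ) ^ 2) * deriv (deriv (Ψ r)) (-Real.cos (2 * θ))
        + 4 * Real.cos (2 * θ) * deriv (Ψ r) (-Real.cos (2 * θ)) := by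
    rw [hang1.deriv_eq]
    have h := ((hg2.hasDerivAt.comp θ (hc θ)).mul hsin).deriv
    refine h.trans ?_
    rw [← Real.sin_sq]
    simp only [Function.comp_apply]
    ring
  rw [potential_eq hθ, hamiltonian, polarLaplacian, hrad, hang,
    angularOp_eq hb0 hb1 hθ.2.2 hg1.self_of_nhds hg2]
  field_simp
  ring

theorem exists_angularPotential_eq (m : ℕ) (α β : ℝ) :
    ∃ N : ℝ[X], ∀ x : ℝ, -1 < x → x < 1 → (seedPoly m α β).eval x ≠ 0 →
      angularPotential m α β x = N.eval x / ((1 - x ^ 2) * (seedPoly m α β).eval x ^ 2) := by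
  set q := angularPoly m α β with hqdef
  set w := cosgroveNum m α β with hwdef
  -- This is `angularPotential_eq` with `W = w/q`, cleared by `(1 - x²) q² = 4 y (1 - y) q²`.
  refine ⟨(C 16 * (X * (1 - X)) * (derivative w * q - w * derivative q)
    + C 8 * w * q * (C 2 * X - 1) + C (2 * cotCoeff m α β) * q ^ 2).comp (C (1 / 2) * (1 - X)),
    fun x h0 h1 hP => ?_⟩
  obtain ⟨y, hy⟩ : ∃ y, y = (1 - x) / 2 := ⟨_, rfl⟩
  have hq : q.eval y ≠ 0 := by
    rw [hqdef, angularPoly_eval, hy]; convert hP using 2; ring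
  have hPq : (seedPoly m α β).eval x = q.eval y := by
    rw [hqdef, angularPoly_eval, hy]; congr 1; ring
  have hd : deriv (cosgroveFun m α β) y = _ := ((w.hasDerivAt y).div (q.hasDerivAt y) hq).deriv
  have hw : cosgroveFun m α β y = w.eval y / q.eval y := rfl
  rw [angularPotential_eq h0 h1 hP hy, hd, hw, hPq]
  have e : (C (1 / 2) * (1 - X) : ℝ[X]).eval x = y := by simp [hy]; ring
  rw [eval_comp, e]
  simp only [eval_add, eval_mul, eval_sub, eval_X, eval_one, eval_C, eval_pow]
  have hy0 : y ≠ 0 := by rw [hy]; linarith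
  have hz0 : 1 - y ≠ 0 := by rw [hy]; linarith
  have ex : 1 - x ^ 2 = 4 * y * (1 - y) := by rw [hy]; ring
  rw [ex]
  field_simp
  ring

/-- With `y = cos² θ` one has `dy/dθ = -2 sin θ cos θ`, `(sin θ cos θ)² = y (1 - y)` and `(sin θ cos
θ)' = 2 y - 1`, which reproduces `angularPotential_eq` term by term. -/
theorem hasDerivAt_angularPrimitive {m : ℕ} {α β θ : ℝ} (hθ : θ ∈ regularAngles m α β) :
    HasDerivAt (angularPrimitive (cotCoeff m α β) (cosgroveFun m α β))
      (angularPotential m α β (-Real.cos (2 * θ))) θ := by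
  obtain ⟨hb0, hb1⟩ := angle_bounds hθ.1 hθ.2.1
  have hs : 0 < Real.sin θ := Real.sin_pos_of_pos_of_lt_pi hθ.1 (by linarith [hθ.2.1, Real.pi_pos])
  have hc : 0 < Real.cos θ := Real.cos_pos_of_mem_Ioo ⟨by linarith [hθ.1, Real.pi_pos], hθ.2.1⟩
  have h2 : Real.sin (2 * θ) = 2 * Real.sin θ * Real.cos θ := Real.sin_two_mul θ
  have h3 : Real.cos (2 * θ) = 2 * Real.cos θ ^ 2 - 1 := Real.cos_two_mul θ
  have h4 := Real.sin_sq_add_cos_sq θ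
  set y := (1 + Real.cos (2 * θ)) / 2 with hy
  have hyx : y = (1 - -Real.cos (2 * θ)) / 2 := by rw [hy]; ring
  have hy0 : y ≠ 0 := by rw [hyx]; linarith
  have hy1 : y ≠ 1 := by rw [hyx]; linarith
  have hq : (angularPoly m α β).eval y ≠ 0 := by
    rw [angularPoly_eval, hyx]; convert hθ.2.2 using 2; ring
  have hW := (hasDerivAt_cosgroveFun hy0 hy1 hq).differentiableAt.hasDerivAt
  rw [angularPotential_eq hb0 hb1 hθ.2.2 hyx]
  have dc := ((hasDerivAt_id' θ).const_mul 2).cos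
  have ds := ((hasDerivAt_id' θ).const_mul 2).sin
  have dy := (dc.const_add 1).div_const 2
  have dW := hW.comp θ dy
  have hne : Real.sin θ * Real.cos θ ≠ 0 := (mul_pos hs hc).ne'
  have hne2 : Real.sin (2 * θ) ≠ 0 := by rw [h2]; positivity
  have h := ((dW.const_mul (-2)).div ((Real.hasDerivAt_sin θ).mul (Real.hasDerivAt_cos θ)) hne).sub
    ((dc.div ds hne2).const_mul (cotCoeff m α β))
  refine HasDerivAt.congr_deriv h ?_
  simp only [Function.comp_apply, Pi.mul_apply, ← hy]
  have hyc : y = Real.cos θ ^ 2 := by rw [hy, h3]; ring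
  have h1y : 1 - y = Real.sin θ ^ 2 := by rw [hyc]; linear_combination -h4
  rw [h1y]
  generalize deriv (cosgroveFun m α β) y = W'
  generalize cosgroveFun m α β y = W
  rw [hyc, h2, h3]
  generalize Real.sin θ = s at *
  generalize Real.cos θ = c at *
  have hs' := hs.ne'
  have hc' := hc.ne'
  field_simp
  linear_combination (4 * cotCoeff m α β * c ^ 2 - 4 * W) * h4

/-! ### Potentials of different index are different -/

/-- The numerator of `y (1 - y) q'(y) / q(y)`, where `q` is the seed polynomial. -/
def logDerivNum (m : ℕ) (α β : ℝ) : ℝ[X] := X * (1 - X) * derivative (angularPoly m α β)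

theorem cosgroveNum_eq (m : ℕ) (α β : ℝ) :
    cosgroveNum m α β = (C (linearConst m α β + 1 + α)
      + C (m + β - α - 1 - (2 * m + β - α) ^ 2 / 4) * X) * angularPoly m α β
      - logDerivNum m α β := by
  have hm : (m + 1 : ℝ) ≠ 0 := by positivity
  rw [cosgroveNum, riccatiNum, logDerivNum, ← mul_assoc (C (m + 1 : ℝ)), ← C_mul,
    mul_one_div_cancel hm]
  simp only [C_add, C_sub, C_1]
  ring

/-- Up to a term that does not depend on `m`, the potential is given by the logarithmic derivative
of the seed polynomial. -/
theorem exists_angularPotential_eq_logDeriv (α β : ℝ) :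
    ∃ R : ℝ → ℝ, ∀ (m : ℕ) (y : ℝ), 0 < y → y < 1 → (angularPoly m α β).eval y ≠ 0 →
      angularPotential m α β (1 - 2 * y) = R y
        - 4 * (((derivative (logDerivNum m α β)).eval y * (angularPoly m α β).eval y
          - (logDerivNum m α β).eval y * (derivative (angularPoly m α β)).eval y)
          / (angularPoly m α β).eval y ^ 2)
        - 2 * ((logDerivNum m α β).eval y / (angularPoly m α β).eval y) * (2 * y - 1)
          / (y * (1 - y)) := by
  -- `R` is the potential of index `0`, whose seed polynomial is `1`.
  refine ⟨fun y => 4 * (β - α - 1 - (β - α) ^ 2 / 4)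
    + (2 * (linearConst 0 α β + 1 + α + (β - α - 1 - (β - α) ^ 2 / 4) * y) * (2 * y - 1)
      + cotCoeff 0 α β / 2) / (y * (1 - y)), fun m y h0 h1 hq => ?_⟩
  have hP : (seedPoly m α β).eval (1 - 2 * y) ≠ 0 := by rwa [← angularPoly_eval]
  have hd : deriv (cosgroveFun m α β) y = _ :=
    (((cosgroveNum m α β).hasDerivAt y).div ((angularPoly m α β).hasDerivAt y) hq).deriv
  rw [angularPotential_eq (y := y) (by linarith) (by linarith) hP (by ring), hd, cosgroveFun,
    cosgroveNum_eq]
  simp only [derivative_sub, derivative_mul, derivative_add, derivative_C, derivative_X, zero_mul,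
    zero_add, mul_one, eval_add, eval_mul, eval_sub, eval_X, eval_C]
  generalize (logDerivNum m α β).eval y = F
  generalize (derivative (logDerivNum m α β)).eval y = F'
  generalize (derivative (angularPoly m α β)).eval y = q'
  generalize (angularPoly m α β).eval y = q at *
  have hy0 : y ≠ 0 := h0.ne'
  have hy1 : 1 - y ≠ 0 := by linarith
  simp only [linearConst, cotCoeff]
  push_cast
  field_simp
  ring

/-- The quotient `Z / Q` of two polynomials is not a multiple of `1 / √(y (1 - y))`. -/
theorem eq_zero_of_sqrt_ode {Z Q : ℝ[X]} (hQ : Q ≠ 0)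
    (h : ((1 - 2 * X) * Z + 2 * X * (1 - X) * derivative Z) * Q
      = 2 * X * (1 - X) * Z * derivative Q) : Z = 0 := by
  by_contra hZ
  obtain ⟨Z₁, hZ₁, hZ0⟩ := exists_eq_pow_rootMultiplicity_mul_and_not_dvd Z hZ 0
  obtain ⟨Q₁, hQ₁, hQ0⟩ := exists_eq_pow_rootMultiplicity_mul_and_not_dvd Q hQ 0
  generalize rootMultiplicity 0 Z = k at *
  generalize rootMultiplicity 0 Q = j at *
  simp only [C_0, sub_zero, X_dvd_iff, coeff_zero_eq_eval_zero] at hZ₁ hQ₁ hZ0 hQ0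
  have hX : ∀ (i : ℕ) (P : ℝ[X]), X * derivative (X ^ i * P) =
      X ^ i * (C (i : ℝ) * P + X * derivative P) := by
    intro i P
    rw [derivative_mul, derivative_X_pow]
    rcases i with _ | i
    · simp
    · simp only [Nat.add_sub_cancel, pow_succ]
      ring
  have h' : X ^ (k + j) * (((1 - 2 * X) * Z₁ + 2 * (1 - X) * (C (k : ℝ) * Z₁ + X * derivative Z₁))
      * Q₁) = X ^ (k + j) * (2 * (1 - X) * Z₁ * (C (j : ℝ) * Q₁ + X * derivative Q₁)) := by
    have e1 := hX k Z₁
    have e2 := hX j Q₁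
    rw [← hZ₁] at e1
    rw [← hQ₁] at e2
    have h'' : (1 - 2 * X) * Z * Q
        + 2 * (1 - X) * (X ^ k * (C (k : ℝ) * Z₁ + X * derivative Z₁)) * Q
        = 2 * (1 - X) * Z * (X ^ j * (C (j : ℝ) * Q₁ + X * derivative Q₁)) := by
      rw [← e1, ← e2]
      linear_combination h
    rw [hZ₁, hQ₁] at h''
    rw [pow_add]
    linear_combination h''
  have h2 := congrArg (Polynomial.eval 0)
    (mul_left_cancel₀ (pow_ne_zero _ (X_ne_zero (R := ℝ))) h')
  -- Comparing orders at `0`: `Z / Q` would have order `k - j = -1/2`, which parity excludes.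
  simp only [eval_add, eval_mul, eval_sub, eval_X, eval_one, eval_C, eval_ofNat, mul_zero, zero_mul,
    sub_zero, add_zero, one_mul, mul_one] at h2
  have h3 : (Z₁.eval 0 * Q₁.eval 0) * (1 + 2 * (k : ℝ) - 2 * j) = 0 := by
    linear_combination h2
  have h4 := (mul_eq_zero.1 h3).resolve_left (mul_ne_zero hZ0 hQ0)
  have h5 : 1 + 2 * (k : ℤ) - 2 * j = 0 := by exact_mod_cast h4
  omega

/-- In the generic case, seed polynomials of different index have different logarithmic
derivatives. -/
theorem wronskian_angularPoly_ne_zero {α β : ℝ} (h : ∀ k : ℤ, α - β ≠ k) {m n : ℕ} (hmn : m ≠ n) :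
    derivative (angularPoly m α β) * angularPoly n α β
      - derivative (angularPoly n α β) * angularPoly m α β ≠ 0 := by
  intro h0
  -- The factor `X` keeps the degree bound at `i` and makes the coefficient there `i` times the
  -- leading one, also for `i = 0`. The top coefficients of the two products then differ by the
  -- factor `m - n`.
  have hdeg : ∀ i : ℕ, (X * derivative (angularPoly i α β)).natDegree ≤ i := by
    intro i
    rw [natDegree_le_iff_coeff_eq_zero]
    rintro (_ | k) hk
    · simp at hk
    · rw [coeff_X_mul, coeff_derivative, coeff_eq_zero_of_natDegree_lt, zero_mul]
      rwa [(angularPoly_natDegree h i).2]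
  have hco : ∀ i : ℕ, (X * derivative (angularPoly i α β)).coeff i =
      i * (angularPoly i α β).coeff i := by
    rintro (_ | k)
    · simp
    · rw [coeff_X_mul, coeff_derivative]
      push_cast
      ring
  have e1 := coeff_mul_add_eq_of_natDegree_le (hdeg m) (angularPoly_natDegree h n).2.le
  have e2 := coeff_mul_add_eq_of_natDegree_le (hdeg n) (angularPoly_natDegree h m).2.le
  have e : X * derivative (angularPoly m α β) * angularPoly n α β
      = X * derivative (angularPoly n α β) * angularPoly m α β := by
    linear_combination X * h0
  rw [e, add_comm, e2, hco, hco] at e1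
  have h3 : ((angularPoly m α β).coeff m * (angularPoly n α β).coeff n) * ((n : ℝ) - m) = 0 := by
    linear_combination e1
  have h4 := (mul_eq_zero.1 h3).resolve_left
    (mul_ne_zero (angularPoly_natDegree h m).1 (angularPoly_natDegree h n).1)
  exact hmn (by exact_mod_cast (sub_eq_zero.1 h4).symm)

/-- If the potentials agreed at all common regular points, then `w = q_m'/q_m - q_n'/q_n` would
satisfy `2 y (1 - y) w' + (1 - 2 y) w = 0`. This is the equation of `eq_zero_of_sqrt_ode` for the
Wronskian over `q_m q_n`; infinitely many points make it a polynomial identity. -/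
theorem exists_angularPotential_ne {α β : ℝ} (h : ∀ k : ℤ, α - β ≠ k) {m n : ℕ} (hmn : m ≠ n) :
    ∃ y : ℝ, 0 < y ∧ y < 1 ∧ (angularPoly m α β).eval y ≠ 0 ∧ (angularPoly n α β).eval y ≠ 0 ∧
      angularPotential m α β (1 - 2 * y) ≠ angularPotential n α β (1 - 2 * y) := by
  by_contra! hcon
  obtain ⟨R, hR⟩ := exists_angularPotential_eq_logDeriv α β
  have hm0 := angularPoly_ne_zero h m
  have hn0 := angularPoly_ne_zero h n
  refine wronskian_angularPoly_ne_zero h hmn (eq_zero_of_sqrt_ode (mul_ne_zero hm0 hn0) ?_)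
  refine eq_of_infinite_eval_eq _ _ (((Set.Ioo_infinite (zero_lt_one' ℝ)).sdiff
    (finite_zeros (mul_ne_zero hm0 hn0))).mono ?_)
  rintro y ⟨⟨h0, h1⟩, hy⟩
  simp only [Set.mem_ofPred_eq, eval_mul, mul_eq_zero, not_or] at hy
  have e := hcon y h0 h1 hy.1 hy.2
  rw [hR m y h0 h1 hy.1, hR n y h0 h1 hy.2] at e
  have hy0 : y ≠ 0 := h0.ne'
  have hy1 : 1 - y ≠ 0 := by linarith
  obtain ⟨hqm, hqn⟩ := hy
  simp only [Set.mem_ofPred_eq, logDerivNum, derivative_sub, derivative_mul, derivative_X,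
    derivative_one, zero_sub, one_mul, eval_add, eval_mul, eval_sub, eval_X, eval_one,
    eval_neg, eval_ofNat] at e ⊢
  generalize (derivative (derivative (angularPoly m α β))).eval y = a2 at *
  generalize (derivative (derivative (angularPoly n α β))).eval y = b2 at *
  generalize (derivative (angularPoly m α β)).eval y = a1 at *
  generalize (derivative (angularPoly n α β)).eval y = b1 at *
  generalize (angularPoly m α β).eval y = a at *
  generalize (angularPoly n α β).eval y = b at *
  field_simp at e
  linear_combination (-1 / 2) * e

end RationalExtension

end

theorem mainTheorem2 (α β : ℝ) :
    (∀ m : ℕ, RationalExtension.seedPoly m α β ≠ 0 →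
      -- the Hamiltonian is `-Δ/2 + V`
      (∀ (ω : ℝ) (Ψ : ℝ → ℝ → ℝ) (r θ : ℝ), 0 < r → θ ∈ RationalExtension.regularAngles m α β →
        ContDiffAt ℝ 2 (fun p : ℝ × ℝ => Ψ p.1 p.2) (r, -Real.cos (2 * θ)) →
        RationalExtension.hamiltonian ω m α β Ψ r (-Real.cos (2 * θ)) =
          -(1 / 2) * RationalExtension.polarLaplacian (fun s t => Ψ s (-Real.cos (2 * t))) r θ
            + RationalExtension.potential ω m α β r θ * Ψ r (-Real.cos (2 * θ))) ∧
      -- the angular part of the potential is a rational function of `x = -cos 2θ`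
      (∃ N : Polynomial ℝ, ∀ ω r θ : ℝ, 0 < r → θ ∈ RationalExtension.regularAngles m α β →
        RationalExtension.potential ω m α β r θ =
          ω ^ 2 * r ^ 2 / 2 + 1 / r ^ 2 * (N.eval (-Real.cos (2 * θ)) /
            ((1 - Real.cos (2 * θ) ^ 2) *
              (RationalExtension.seedPoly m α β).eval (-Real.cos (2 * θ)) ^ 2))) ∧
      ∃ (W : ℝ → ℝ) (q₇ q₈ q₉ q₁₀ : ℝ),
        -- `W` is a rational function whose poles are zeros of the seed polynomial
        (∃ N : Polynomial ℝ, ∀ y : ℝ,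
          W y = N.eval y / (RationalExtension.seedPoly m α β).eval (1 - 2 * y)) ∧
        -- the potential is given by `W`
        (∀ ω r θ : ℝ, 0 < r → θ ∈ RationalExtension.regularAngles m α β →
          DifferentiableAt ℝ
              (RationalExtension.angularPrimitive (RationalExtension.cotCoeff m α β) W) θ ∧
            RationalExtension.potential ω m α β r θ =
              ω ^ 2 * r ^ 2 / 2 + 1 / r ^ 2 *
                deriv (RationalExtension.angularPrimitive
                  (RationalExtension.cotCoeff m α β) W) θ) ∧
        -- `W` satisfies SD-I.a
        RationalExtension.IsSDIaSolutionOn q₇ q₈ q₉ q₁₀ W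
          (RationalExtension.regularPoints m α β) ∧
        -- `W` is expressed through a solution of the sixth Painlevé equation
        ∃ (γ₁ γ₂ γ₃ γ₄ t : ℝ) (u : ℝ → ℝ) (S : Set ℝ), t ^ 2 = 2 * γ₁ ∧ S.Finite ∧
          RationalExtension.IsPVISolutionOn γ₁ γ₂ γ₃ γ₄ u
            (RationalExtension.regularPoints m α β \ S) ∧
          ∀ y ∈ RationalExtension.regularPoints m α β \ S,
            W y = RationalExtension.cosgroveExpr γ₂ γ₃ γ₄ t u y) ∧
    -- the family is infinite: in the generic case the potentials are pairwise distinct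
    ((∀ k : ℤ, α - β ≠ k) →
      (∀ m : ℕ, RationalExtension.seedPoly m α β ≠ 0) ∧
      ∀ m n : ℕ, m ≠ n →
        ∃ θ ∈ RationalExtension.regularAngles m α β ∩ RationalExtension.regularAngles n α β,
          ∀ ω r : ℝ, 0 < r →
            RationalExtension.potential ω m α β r θ ≠
              RationalExtension.potential ω n α β r θ) := by
  open RationalExtension in
  refine ⟨fun m hm => ⟨fun ω Ψ r θ hr hθ hΨ => hamiltonian_eq hr hθ hΨ, ?_, ?_⟩, fun h => ⟨?_, ?_⟩⟩
  · obtain ⟨N, hN⟩ := exists_angularPotential_eq m α β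
    refine ⟨N, fun ω r θ hr hθ => ?_⟩
    obtain ⟨hb0, hb1⟩ := angle_bounds hθ.1 hθ.2.1
    rw [potential_eq hθ, hN _ hb0 hb1 hθ.2.2, neg_sq]
  · obtain ⟨q₇, q₈, q₉, q₁₀, hsd⟩ := isSDIaSolutionOn_cosgroveFun m α β
    refine ⟨cosgroveFun m α β, q₇, q₈, q₉, q₁₀, ⟨cosgroveNum m α β, fun y => ?_⟩,
      fun ω r θ _ hθ => ⟨(hasDerivAt_angularPrimitive hθ).differentiableAt, ?_⟩, hsd,
      hasPVIRepresentation_cosgroveFun ((seedPoly_ne_zero_iff m α β).1 hm)⟩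
    · rw [cosgroveFun, angularPoly_eval]
    · rw [(hasDerivAt_angularPrimitive hθ).deriv, potential_eq hθ]
  · exact fun m => (seedPoly_ne_zero_iff m α β).2 (angularPoly_ne_zero h m)
  · intro m n hmn
    obtain ⟨y, h0, h1, hm, hn, hne⟩ := exists_angularPotential_ne h hmn
    -- The angle inverts `y = (1 + cos 2θ)/2`.
    have hcos : -Real.cos (2 * (Real.arccos (2 * y - 1) / 2)) = 1 - 2 * y := by
      rw [mul_div_cancel₀ _ two_ne_zero, Real.cos_arccos (by linarith) (by linarith)]
      ring
    have hpos : 0 < Real.arccos (2 * y - 1) := Real.arccos_pos.2 (by linarith)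
    have hlt : Real.arccos (2 * y - 1) < Real.pi := by
      refine (Real.arccos_le_pi _).lt_of_ne fun he => ?_
      have := Real.cos_arccos (x := 2 * y - 1) (by linarith) (by linarith)
      rw [he, Real.cos_pi] at this
      linarith
    have hreg : ∀ i : ℕ, (angularPoly i α β).eval y ≠ 0 →
        Real.arccos (2 * y - 1) / 2 ∈ regularAngles i α β := fun i hi =>
      ⟨by linarith, by linarith, by rwa [hcos, ← angularPoly_eval]⟩
    refine ⟨Real.arccos (2 * y - 1) / 2, ⟨hreg m hm, hreg n hn⟩, fun ω r hr he => hne ?_⟩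
    rw [potential_eq (hreg m hm), potential_eq (hreg n hn), hcos] at he
    have hr2 : 1 / r ^ 2 ≠ 0 := by positivity
    exact mul_left_cancel₀ hr2 (add_left_cancel he)
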